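/- For a finite simple undirected graph $G$ let $A_G$ be its adjacency matrix, $I$ the identity matrix of the same size, and let $\mathrm{rank}$ denote the rank over $\mathbb{R}$. For positive integers $s,t$, the Rank-Ramsey number $R^k(s,t)$ is the least number $N$ such that every graph $G$ on $N$ vertices contains an $s$-clique or satisfies $\mathrm{rank}(A_G+I)\ge t$. Then for all integers $t$ with $2\le t\le 5$ and all integers $s>1$, $$R^k(s,t)=(s-1)(t-1)+1 .$$ In particular, every finite graph $G$ with $\mathrm{rank}(A_G+I)\le t-1$ and no $s$-clique has at most $(s-1)(t-1)$ vertices. -/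

import Mathlib

open Classical in
/-- The rank of `A_G + I` over the reals, where `A_G` is the adjacency matrix of the finite
simple graph `G`. -/
noncomputable def complementRank {V : Type*} [Fintype V] (G : SimpleGraph V) : ℕ :=
  (G.adjMatrix ℝ + (1 : Matrix V V ℝ)).rank

/-- Every graph of order `N` has an `s`-clique, or satisfies `rank (A_G + I) ≥ t`. -/
def RankRamseyProperty (s t N : ℕ) : Prop :=
  ∀ G : SimpleGraph (Fin N),
    (∃ K : Finset (Fin N), G.IsNClique s K) ∨ t ≤ complementRank G

/-- The Rank-Ramsey number `R^k(s,t)`: the least `N` such that every graph of order `N` has an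
`s`-clique or satisfies `rank (A_G + I) ≥ t`. If no such `N` existed the value would be `0`;
an equation with a positive right-hand side therefore includes that such an `N` exists. -/
noncomputable def rankRamseyNumber (s t : ℕ) : ℕ :=
  sInf {N : ℕ | RankRamseyProperty s t N}

/-! When `r = rank (A_G + I) ≤ 4`, the vertices are covered by `r` cliques, so a graph without `s +
1` mutually adjacent vertices has at most `s * r` vertices. Disjoint unions of cliques attain this.
For the cover, take a maximum independent tuple `u` of size `k ≤ r`. Vertices whose only neighbour
in `u` is a given member form a clique. If these classes miss a vertex, then `r ≥ k + 1`, leaving `k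
= 2` and `k = 3`; there, nonzero Schur complement minors force rank and exclude bad configurations.
-/

open Matrix

namespace SimpleGraph

variable {V : Type*} (G : SimpleGraph V)

/-- Adjacency in the reflexive closure of a graph. -/
def ClosedAdj (x y : V) : Prop := x = y ∨ G.Adj x y

open Classical in
/-- The 0/1 matrix `A_G + I` of closed adjacency. -/
noncomputable def closedAdjMatrix : Matrix V V ℝ :=
  of fun x y => if G.ClosedAdj x y then 1 else 0

/-- A tuple of distinct, pairwise nonadjacent vertices. -/
def IsIndepTuple {k : ℕ} (u : Fin k → V) : Prop :=
  ∀ i j, i ≠ j → ¬ G.ClosedAdj (u i) (u j)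

variable {G}

theorem closedAdj_refl (x : V) : G.ClosedAdj x x := Or.inl rfl

theorem ClosedAdj.symm {x y : V} (h : G.ClosedAdj x y) : G.ClosedAdj y x :=
  h.imp Eq.symm fun h => h.symm

theorem closedAdj_comm {x y : V} : G.ClosedAdj x y ↔ G.ClosedAdj y x :=
  ⟨ClosedAdj.symm, ClosedAdj.symm⟩

theorem closedAdjMatrix_of_closedAdj {x y : V} (h : G.ClosedAdj x y) :
    G.closedAdjMatrix x y = 1 := by simp [closedAdjMatrix, h]

theorem closedAdjMatrix_of_not_closedAdj {x y : V} (h : ¬ G.ClosedAdj x y) :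
    G.closedAdjMatrix x y = 0 := by simp [closedAdjMatrix, h]

theorem closedAdjMatrix_self (x : V) : G.closedAdjMatrix x x = 1 :=
  closedAdjMatrix_of_closedAdj (closedAdj_refl x)

theorem closedAdjMatrix_comm (x y : V) : G.closedAdjMatrix x y = G.closedAdjMatrix y x := by
  classical
  exact if_congr closedAdj_comm rfl rfl

theorem closedAdjMatrix_cases (x y : V) :
    G.ClosedAdj x y ∧ G.closedAdjMatrix x y = 1 ∨
      ¬ G.ClosedAdj x y ∧ G.closedAdjMatrix x y = 0 := by
  by_cases h : G.ClosedAdj x y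
  · exact Or.inl ⟨h, closedAdjMatrix_of_closedAdj h⟩
  · exact Or.inr ⟨h, closedAdjMatrix_of_not_closedAdj h⟩

theorem complementRank_eq_rank_closedAdjMatrix [Fintype V] (G : SimpleGraph V) :
    complementRank G = G.closedAdjMatrix.rank := by
  classical
  unfold complementRank
  congr 1
  ext x y
  by_cases h : x = y
  · subst h
    simp [closedAdjMatrix_self]
  · simp [closedAdjMatrix, ClosedAdj, h, Matrix.one_apply_ne h, adjMatrix_apply]

/-! ### Rank bounds from Schur complements -/

/-- If the Schur complement of an independent tuple `u` in the principal submatrix on `u` and `x`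
is nonsingular, then so is that submatrix, and its size bounds the rank from below. -/
theorem add_le_rank_closedAdjMatrix [Fintype V] {k m : ℕ} {u : Fin k → V}
    (hu : G.IsIndepTuple u) (x : Fin m → V)
    (hdet : (of fun i j => G.closedAdjMatrix (x i) (x j) -
      ∑ l, G.closedAdjMatrix (x i) (u l) * G.closedAdjMatrix (x j) (u l)).det ≠ 0) :
    k + m ≤ G.closedAdjMatrix.rank := by
  classical
  let f : Fin k ⊕ Fin m → V := Sum.elim u x
  have hblock : G.closedAdjMatrix.submatrix f f =
      fromBlocks 1 (G.closedAdjMatrix.submatrix u x) (G.closedAdjMatrix.submatrix x u)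
        (G.closedAdjMatrix.submatrix x x) := by
    ext (i | i) (j | j)
    · by_cases h : i = j
      · subst h
        simp [f, closedAdjMatrix_self]
      · simp [f, Matrix.one_apply_ne h, closedAdjMatrix_of_not_closedAdj (hu i j h)]
    all_goals simp [f]
  have hd : (G.closedAdjMatrix.submatrix f f).det ≠ 0 := by
    rw [hblock, det_fromBlocks_one₁₁]
    convert hdet using 2
    ext i j
    simp [Matrix.mul_apply, closedAdjMatrix_comm (x j)]
  have hr := rank_of_isUnit _ ((Matrix.isUnit_iff_isUnit_det _).2 hd.isUnit)
  have hle := rank_submatrix_le G.closedAdjMatrix f f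
  rw [hr] at hle
  simpa using hle

theorem IsIndepTuple.le_rank [Fintype V] {k : ℕ} {u : Fin k → V} (hu : G.IsIndepTuple u) :
    k ≤ G.closedAdjMatrix.rank := by
  simpa using add_le_rank_closedAdjMatrix hu (m := 0) Fin.elim0 (by simp)

/-- A vertex with at least two neighbours in an independent tuple raises the rank. -/
theorem IsIndepTuple.succ_le_rank [Fintype V] {k : ℕ} {u : Fin k → V} (hu : G.IsIndepTuple u)
    {x : V} {i j : Fin k} (hij : i ≠ j) (hi : G.ClosedAdj x (u i)) (hj : G.ClosedAdj x (u j)) :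
    k + 1 ≤ G.closedAdjMatrix.rank := by
  refine add_le_rank_closedAdjMatrix hu (fun _ : Fin 1 => x) ?_
  have h : ∑ l ∈ {i, j}, G.closedAdjMatrix x (u l) * G.closedAdjMatrix x (u l) ≤
      ∑ l, G.closedAdjMatrix x (u l) * G.closedAdjMatrix x (u l) :=
    Finset.sum_le_sum_of_subset_of_nonneg (Finset.subset_univ _)
      fun l _ _ => mul_self_nonneg _
  rw [Finset.sum_pair hij, closedAdjMatrix_of_closedAdj hi, closedAdjMatrix_of_closedAdj hj] at h
  rw [det_unique]
  simp only [of_apply, closedAdjMatrix_self]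
  intro h0
  linarith

/-- Rank below `k + 2` forces the principal minors of order two of the Schur complement to vanish.
-/
theorem IsIndepTuple.schur_eq [Fintype V] {k : ℕ} {u : Fin k → V} (hu : G.IsIndepTuple u)
    (hr : G.closedAdjMatrix.rank < k + 2) (x y : V) :
    (1 - ∑ l, G.closedAdjMatrix x (u l) * G.closedAdjMatrix x (u l)) *
      (1 - ∑ l, G.closedAdjMatrix y (u l) * G.closedAdjMatrix y (u l)) =
    (G.closedAdjMatrix x y - ∑ l, G.closedAdjMatrix x (u l) * G.closedAdjMatrix y (u l)) ^ 2 := by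
  by_contra h
  refine hr.not_ge (add_le_rank_closedAdjMatrix hu ![x, y] ?_)
  rw [det_fin_two]
  simp only [of_apply, cons_val_zero, cons_val_one, closedAdjMatrix_self]
  rw [closedAdjMatrix_comm y x]
  simp only [mul_comm (G.closedAdjMatrix y (u _)) (G.closedAdjMatrix x (u _))]
  intro h0
  apply h
  linarith

/-! ### Maximum independent tuples and clique covers -/

theorem IsIndepTuple.cons {k : ℕ} {u : Fin k → V} (hu : G.IsIndepTuple u) {x : V}
    (hx : ∀ l, ¬ G.ClosedAdj x (u l)) : G.IsIndepTuple (Fin.cons x u : Fin (k + 1) → V) := by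
  intro i j hij
  induction i using Fin.cases with
  | zero =>
    induction j using Fin.cases with
    | zero => exact absurd rfl hij
    | succ j => simpa using hx j
  | succ i =>
    induction j using Fin.cases with
    | zero => simpa [closedAdj_comm] using hx i
    | succ j => simpa using hu i j fun h => hij (by rw [h])

theorem IsIndepTuple.update {k : ℕ} {u : Fin k → V} (hu : G.IsIndepTuple u) {x : V} {i : Fin k}
    (hx : ∀ l, l ≠ i → ¬ G.ClosedAdj x (u l)) : G.IsIndepTuple (Function.update u i x) := by
  intro a b hab
  by_cases ha : a = i
  · subst ha
    simpa [Function.update_of_ne hab.symm] using hx b hab.symm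
  · by_cases hb : b = i
    · subst hb
      simpa [Function.update_of_ne hab, closedAdj_comm] using hx a hab
    · simpa [Function.update_of_ne ha, Function.update_of_ne hb] using hu a b hab

/-- Private neighbours of a member of a maximum independent tuple form a clique. -/
theorem IsIndepTuple.closedAdj_of_private {k : ℕ} {u : Fin k → V} (hu : G.IsIndepTuple u)
    (hmax : ∀ w : Fin (k + 1) → V, ¬ G.IsIndepTuple w) {x y : V} {i : Fin k}
    (hx : ∀ l, l ≠ i → ¬ G.ClosedAdj x (u l)) (hy : ∀ l, l ≠ i → ¬ G.ClosedAdj y (u l)) :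
    G.ClosedAdj x y := by
  by_contra h
  refine hmax _ ((hu.update hy).cons (x := x) fun l => ?_)
  by_cases hl : l = i
  · subst hl
    simpa using h
  · simpa [Function.update_of_ne hl] using hx l hl

theorem exists_max_isIndepTuple [Fintype V] (G : SimpleGraph V) :
    ∃ k, (∃ u : Fin k → V, G.IsIndepTuple u) ∧ ∀ w : Fin (k + 1) → V, ¬ G.IsIndepTuple w := by
  classical
  have h0 : ∃ u : Fin 0 → V, G.IsIndepTuple u := ⟨Fin.elim0, fun i => i.elim0⟩
  let P : ℕ → Prop := fun k => ∃ u : Fin k → V, G.IsIndepTuple u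
  refine ⟨Nat.findGreatest P G.closedAdjMatrix.rank,
    Nat.findGreatest_spec (P := P) (Nat.zero_le _) h0, fun w hw => ?_⟩
  exact Nat.findGreatest_is_greatest (P := P) (Nat.lt_succ_self _) hw.le_rank ⟨w, hw⟩

theorem compl_colorable_of_closedAdj {n : ℕ} (c : V → Fin n)
    (hc : ∀ x y, c x = c y → G.ClosedAdj x y) : Gᶜ.Colorable n :=
  ⟨Coloring.mk c fun {x y} hxy h => by
    rw [compl_adj] at hxy
    exact (hc x y h).elim hxy.1 hxy.2⟩

/-- By `hR` the vertices with two or more neighbours in `u` form one extra clique, beside the `k`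
private classes. -/
theorem IsIndepTuple.compl_colorable_succ {k : ℕ} {u : Fin k → V} (hu : G.IsIndepTuple u)
    (hmax : ∀ w : Fin (k + 1) → V, ¬ G.IsIndepTuple w)
    (hR : ∀ x y, (∃ i j, i ≠ j ∧ G.ClosedAdj x (u i) ∧ G.ClosedAdj x (u j)) →
      (∃ i j, i ≠ j ∧ G.ClosedAdj y (u i) ∧ G.ClosedAdj y (u j)) → G.ClosedAdj x y) :
    Gᶜ.Colorable (k + 1) := by
  have h : ∀ x, ∃ c : Fin (k + 1),
      (c = Fin.last k ∧ ∃ i j, i ≠ j ∧ G.ClosedAdj x (u i) ∧ G.ClosedAdj x (u j)) ∨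
      ∃ i : Fin k, c = i.castSucc ∧ ∀ l, l ≠ i → ¬ G.ClosedAdj x (u l) := by
    intro x
    by_cases hx : ∃ i j, i ≠ j ∧ G.ClosedAdj x (u i) ∧ G.ClosedAdj x (u j)
    · exact ⟨_, Or.inl ⟨rfl, hx⟩⟩
    · obtain ⟨i, hi⟩ : ∃ i, G.ClosedAdj x (u i) := by
        by_contra! h
        exact hmax _ (hu.cons h)
      exact ⟨_, Or.inr ⟨i, rfl, fun l hl h => hx ⟨l, i, hl, h, hi⟩⟩⟩
  choose c hc using h
  refine compl_colorable_of_closedAdj c fun x y hxy => ?_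
  rcases hc x with ⟨hx, hx'⟩ | ⟨i, hx, hx'⟩ <;> rcases hc y with ⟨hy, hy'⟩ | ⟨j, hy, hy'⟩
  · exact hR x y hx' hy'
  · rw [hx, hy] at hxy
    exact absurd hxy.symm (Fin.castSucc_lt_last j).ne
  · rw [hx, hy] at hxy
    exact absurd hxy (Fin.castSucc_lt_last i).ne
  · rw [hx, hy] at hxy
    have hij := Fin.castSucc_injective _ hxy
    subst hij
    exact hu.closedAdj_of_private hmax hx' hy'

theorem IsIndepTuple.compl_colorable {k : ℕ} {u : Fin k → V} (hu : G.IsIndepTuple u)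
    (hmax : ∀ w : Fin (k + 1) → V, ¬ G.IsIndepTuple w)
    (hR : ∀ x i j, i ≠ j → G.ClosedAdj x (u i) → ¬ G.ClosedAdj x (u j)) :
    Gᶜ.Colorable k := by
  have h : ∀ x, ∃ i, G.ClosedAdj x (u i) := by
    intro x
    by_contra! h
    exact hmax _ (hu.cons h)
  choose c hc using h
  refine compl_colorable_of_closedAdj c fun x y hxy => ?_
  refine hu.closedAdj_of_private hmax (i := c x) (fun l hl h => hR x l _ hl h (hc x))
    fun l hl h => hR y l _ (hxy ▸ hl) h (hc y)

/-- Two nonadjacent common neighbours of a nonadjacent pair form an induced 4-cycle. -/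
theorem IsIndepTuple.four_le_rank [Fintype V] {u : Fin 2 → V} (hu : G.IsIndepTuple u) {x y : V}
    (hx : ∀ i, G.ClosedAdj x (u i)) (hy : ∀ i, G.ClosedAdj y (u i)) (hxy : ¬ G.ClosedAdj x y) :
    4 ≤ G.closedAdjMatrix.rank := by
  by_contra h
  have := hu.schur_eq (by omega) x y
  simp [closedAdjMatrix_of_closedAdj, hx, hy, closedAdjMatrix_of_not_closedAdj hxy] at this
  norm_num at this

/-- The wheel with four spokes has a closed adjacency matrix of rank five. -/
theorem IsIndepTuple.five_le_rank [Fintype V] {u : Fin 2 → V} (hu : G.IsIndepTuple u) {x y z : V}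
    (hx : ∀ i, G.ClosedAdj x (u i)) (hy : ∀ i, G.ClosedAdj y (u i)) (hxy : ¬ G.ClosedAdj x y)
    (hz : ∀ i, G.ClosedAdj z (u i)) (hzx : G.ClosedAdj z x) (hzy : G.ClosedAdj z y) :
    5 ≤ G.closedAdjMatrix.rank := by
  refine add_le_rank_closedAdjMatrix hu ![x, y, z] ?_
  rw [det_fin_three]
  simp [closedAdjMatrix_of_closedAdj, hx, hy, hz, hzx, hzy, hzx.symm, hzy.symm,
    closedAdjMatrix_self, closedAdjMatrix_of_not_closedAdj hxy,
    closedAdjMatrix_of_not_closedAdj fun h => hxy (ClosedAdj.symm h)]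
  norm_num

/-- A vertex joined to the whole 4-cycle would give rank five, so each vertex misses a corner.
Vertices missing the same corner form a clique, as no three vertices are independent. -/
theorem compl_colorable_four_of_cycle [Fintype V] {u : Fin 2 → V} (hu : G.IsIndepTuple u)
    (hmax : ∀ w : Fin 3 → V, ¬ G.IsIndepTuple w) (hr : G.closedAdjMatrix.rank ≤ 4) {x y : V}
    (hx : ∀ i, G.ClosedAdj x (u i)) (hy : ∀ i, G.ClosedAdj y (u i)) (hxy : ¬ G.ClosedAdj x y) :
    Gᶜ.Colorable 4 := by
  have h : ∀ z, ∃ c : Fin 4, ¬ G.ClosedAdj z (![u 0, u 1, x, y] c) := by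
    intro z
    by_contra! h
    have := hu.five_le_rank hx hy hxy (Fin.forall_fin_two.2 ⟨h 0, h 1⟩) (h 2) (h 3)
    omega
  choose c hc using h
  refine compl_colorable_of_closedAdj c fun z w hzw => ?_
  by_contra hn
  have h1 := hc z
  have h2 := hc w
  rw [← hzw] at h2
  refine hmax ![z, w, ![u 0, u 1, x, y] (c z)] fun i j hij => ?_
  fin_cases i <;> fin_cases j <;> first | exact absurd rfl hij | skip
  · exact hn
  · exact h1
  · exact fun h => hn h.symm
  · exact h2
  · exact fun h => h1 h.symm
  · exact fun h => h2 h.symm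

theorem compl_colorable_rank_of_two [Fintype V] {u : Fin 2 → V} (hu : G.IsIndepTuple u)
    (hmax : ∀ w : Fin 3 → V, ¬ G.IsIndepTuple w) (hr : G.closedAdjMatrix.rank ≤ 4)
    (hr3 : 3 ≤ G.closedAdjMatrix.rank) : Gᶜ.Colorable G.closedAdjMatrix.rank := by
  by_cases h : ∃ x y, (∀ i, G.ClosedAdj x (u i)) ∧ (∀ i, G.ClosedAdj y (u i)) ∧ ¬ G.ClosedAdj x y
  · obtain ⟨x, y, hx, hy, hxy⟩ := h
    exact (compl_colorable_four_of_cycle hu hmax hr hx hy hxy).mono (hu.four_le_rank hx hy hxy)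
  · push Not at h
    have key : ∀ x, (∃ i j, i ≠ j ∧ G.ClosedAdj x (u i) ∧ G.ClosedAdj x (u j)) →
        ∀ i, G.ClosedAdj x (u i) := by
      rintro x ⟨i, j, hij, hi, hj⟩ l
      by_cases hl : l = i
      · rwa [hl]
      · have : l = j := by omega
        rwa [this]
    exact (hu.compl_colorable_succ hmax fun x y hx hy => h x y (key x hx) (key y hy)).mono hr3

theorem compl_colorable_rank_of_three [Fintype V] {u : Fin 3 → V} (hu : G.IsIndepTuple u)
    (hmax : ∀ w : Fin 4 → V, ¬ G.IsIndepTuple w) (hr : G.closedAdjMatrix.rank = 4) :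
    Gᶜ.Colorable 4 := by
  have schur := hu.schur_eq (by omega)
  simp only [Fin.sum_univ_three] at schur
  have hex : ∀ x, G.ClosedAdj x (u 0) ∨ G.ClosedAdj x (u 1) ∨ G.ClosedAdj x (u 2) := by
    intro x
    by_contra! h
    exact hmax _ (hu.cons (x := x) (Fin.forall_fin_succ.2 ⟨h.1, Fin.forall_fin_two.2 h.2⟩))
  by_cases h : ∃ z, ∀ i, G.ClosedAdj z (u i)
  · obtain ⟨z, hz⟩ := h
    have key : ∀ x, (∃ i j, i ≠ j ∧ G.ClosedAdj x (u i) ∧ G.ClosedAdj x (u j)) →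
        ∀ i, G.ClosedAdj x (u i) := by
      rintro x ⟨i, j, hij, hi, hj⟩
      have hs := schur z x
      simp only [closedAdjMatrix_of_closedAdj (hz _)] at hs
      have hall : G.ClosedAdj x (u 0) ∧ G.ClosedAdj x (u 1) ∧ G.ClosedAdj x (u 2) := by
        -- With exactly two neighbours in `u`, the identity would read `2 = (e - 2) ^ 2` with `e`
        -- equal to 0 or 1.
        by_contra hn
        rcases closedAdjMatrix_cases (G := G) z x with ⟨_, e⟩ | ⟨_, e⟩ <;>
        rcases closedAdjMatrix_cases (G := G) x (u 0) with ⟨h0, e0⟩ | ⟨h0, e0⟩ <;>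
        rcases closedAdjMatrix_cases (G := G) x (u 1) with ⟨h1, e1⟩ | ⟨h1, e1⟩ <;>
        rcases closedAdjMatrix_cases (G := G) x (u 2) with ⟨h2, e2⟩ | ⟨h2, e2⟩ <;>
        rw [e, e0, e1, e2] at hs <;> first
          | exact hn ⟨h0, h1, h2⟩
          | (norm_num at hs; done)
          | (fin_cases i <;> fin_cases j <;> first
              | exact absurd rfl hij
              | exact absurd hi ‹_›
              | exact absurd hj ‹_›)
      exact Fin.forall_fin_succ.2 ⟨hall.1, Fin.forall_fin_two.2 hall.2⟩
    refine hu.compl_colorable_succ hmax fun x y hx hy => ?_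
    by_contra hxy
    have := schur x y
    simp only [closedAdjMatrix_of_closedAdj (key x hx _), closedAdjMatrix_of_closedAdj (key y hy _),
      closedAdjMatrix_of_not_closedAdj hxy] at this
    norm_num at this
  · push Not at h
    -- The neighbours of `x` in `u` form a nonempty proper subset of a cyclic triple, so some
    -- neighbour has a non-neighbour as cyclic predecessor (`c + 2 = c - 1`).
    have hc : ∀ x, ∃ c : Fin 3, G.ClosedAdj x (u c) ∧ ¬ G.ClosedAdj x (u (c + 2)) := by
      intro x
      by_contra! hn
      have h0 : G.ClosedAdj x (u 0) → G.ClosedAdj x (u 2) := hn 0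
      have h1 : G.ClosedAdj x (u 1) → G.ClosedAdj x (u 0) := hn 1
      have h2 : G.ClosedAdj x (u 2) → G.ClosedAdj x (u 1) := hn 2
      obtain ⟨l, hl⟩ := h x
      have hx := hex x
      fin_cases l <;> simp only [Fin.zero_eta, Fin.mk_one, Fin.reduceFinMk] at hl <;> tauto
    choose c hc using hc
    refine (compl_colorable_of_closedAdj c fun x y hxy => ?_).mono (by norm_num : 3 ≤ 4)
    have hx := hc x
    have hy := hc y
    rw [← hxy] at hy
    have hs := hu.schur_eq (by omega) x y
    have hsum (f : Fin 3 → ℝ) : ∑ l, f l = f (c x) + f (c x + 1) + f (c x + 2) := by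
      generalize c x = i
      fin_cases i <;> simp [Fin.sum_univ_three] <;> ring
    rw [hsum, hsum, hsum, closedAdjMatrix_of_closedAdj hx.1, closedAdjMatrix_of_closedAdj hy.1,
      closedAdjMatrix_of_not_closedAdj hx.2, closedAdjMatrix_of_not_closedAdj hy.2] at hs
    -- For nonadjacent `x`, `y` of one colour, with entries `a`, `b` at `c x + 1`, the identity
    -- reads `a * b = (1 + a * b) ^ 2`, impossible for 0/1 values.
    by_contra hn
    rw [closedAdjMatrix_of_not_closedAdj hn] at hs
    rcases closedAdjMatrix_cases (G := G) x (u (c x + 1)) with ⟨_, e⟩ | ⟨_, e⟩ <;>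
    rcases closedAdjMatrix_cases (G := G) y (u (c x + 1)) with ⟨_, e'⟩ | ⟨_, e'⟩ <;>
    rw [e, e'] at hs <;> norm_num at hs

theorem compl_colorable_complementRank [Fintype V] (hr : complementRank G ≤ 4) :
    Gᶜ.Colorable (complementRank G) := by
  rw [complementRank_eq_rank_closedAdjMatrix] at *
  obtain ⟨k, ⟨u, hu⟩, hmax⟩ := G.exists_max_isIndepTuple
  by_cases hR : ∀ x i j, i ≠ j → G.ClosedAdj x (u i) → ¬ G.ClosedAdj x (u j)
  · exact (hu.compl_colorable hmax hR).mono hu.le_rank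
  · push Not at hR
    obtain ⟨x, i, j, hij, hi, hj⟩ := hR
    have hk := hu.succ_le_rank hij hi hj
    have hk4 : k ≤ 3 := by omega
    interval_cases k
    · exact i.elim0
    · exact absurd (Subsingleton.elim i j) hij
    · exact compl_colorable_rank_of_two hu hmax hr hk
    · have hr4 := le_antisymm hr hk
      rw [hr4]
      exact compl_colorable_rank_of_three hu hmax hr4

/-! ### From clique covers to Ramsey numbers -/

theorem card_le_of_compl_colorable [Fintype V] {n s : ℕ} (hc : Gᶜ.Colorable n)
    (hs : ¬ ∃ K : Finset V, G.IsNClique (s + 1) K) : Fintype.card V ≤ s * n := by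
  classical
  obtain ⟨c⟩ := hc
  have := Finset.card_le_mul_card_image_of_maps_to (s := Finset.univ) (t := Finset.univ)
    (f := c) (fun _ _ => Finset.mem_univ _) s ?_
  · simpa using this
  · intro b _
    by_contra! hlt
    obtain ⟨K, hK, hcard⟩ := Finset.exists_subset_card_eq (Nat.succ_le_of_lt hlt)
    refine hs ⟨K, ⟨fun x hx y hy hxy => ?_, hcard⟩⟩
    have hx := (Finset.mem_filter.1 (hK hx)).2
    have hy := (Finset.mem_filter.1 (hK hy)).2
    by_contra hn
    exact c.valid (show Gᶜ.Adj x y from ⟨hxy, hn⟩) (hx.trans hy.symm)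

/-- The disjoint union of cliques given by the fibres of a map. -/
def fiberCliques {ι : Type*} (f : V → ι) : SimpleGraph V where
  Adj x y := x ≠ y ∧ f x = f y
  symm := ⟨fun _ _ h => ⟨h.1.symm, h.2.symm⟩⟩
  loopless := ⟨fun _ h => h.1 rfl⟩

theorem complementRank_fiberCliques_le [Fintype V] {n : ℕ} (f : V → Fin n) :
    complementRank (fiberCliques f) ≤ n := by
  classical
  let B : Matrix V (Fin n) ℝ := of fun x i => if f x = i then 1 else 0
  have h : (fiberCliques f).closedAdjMatrix = B * Bᵀ := by
    ext x y
    have : (fiberCliques f).ClosedAdj x y ↔ f x = f y := by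
      constructor
      · rintro (rfl | h)
        · rfl
        · exact h.2
      · intro h
        by_cases hxy : x = y
        · exact Or.inl hxy
        · exact Or.inr ⟨hxy, h⟩
    simp [closedAdjMatrix, this, B, Matrix.mul_apply, eq_comm]
  rw [complementRank_eq_rank_closedAdjMatrix, h]
  exact (rank_mul_le_left _ _).trans ((rank_le_card_width _).trans_eq (Fintype.card_fin n))

theorem not_rankRamseyProperty {s t N : ℕ} (hN : N ≤ s * t) :
    ¬ RankRamseyProperty (s + 1) (t + 1) N := by
  intro h
  have hs (x : Fin N) : 0 < s := Nat.pos_of_ne_zero fun h => by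
    subst h
    have := x.2
    omega
  -- Consecutive blocks of length `s` serve as the cliques; residues mod `s` separate the vertices
  -- within a block.
  let f : Fin N → Fin t := fun x => ⟨x / s, Nat.div_lt_of_lt_mul (x.2.trans_le hN)⟩
  rcases h (fiberCliques f) with ⟨K, hK⟩ | h
  · have hle : K.card ≤ (Finset.range s).card := by
      refine Finset.card_le_card_of_injOn (fun x => (x : ℕ) % s)
        (fun x _ => by simpa using Nat.mod_lt _ (hs x)) fun x hx y hy hxy => ?_
      by_contra hne
      have hf := congrArg Fin.val (hK.1 hx hy hne).2
      apply hne
      ext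
      rw [← Nat.div_add_mod x s, ← Nat.div_add_mod y s]
      simp only [f] at hf hxy
      rw [hf, hxy]
    rw [hK.2, Finset.card_range] at hle
    omega
  · have := complementRank_fiberCliques_le f
    omega

theorem card_le_of_complementRank_le [Fintype V] {s t : ℕ} (ht : t ≤ 4)
    (hr : complementRank G ≤ t) (hs : ¬ ∃ K : Finset V, G.IsNClique (s + 1) K) :
    Fintype.card V ≤ s * t :=
  card_le_of_compl_colorable ((compl_colorable_complementRank (hr.trans ht)).mono hr) hs

end SimpleGraph

theorem theorem3 (s t : ℕ) (hs : 1 < s) (ht2 : 2 ≤ t) (ht5 : t ≤ 5) :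
    rankRamseyNumber s t = (s - 1) * (t - 1) + 1 ∧
      ∀ (V : Type*) [Fintype V] (G : SimpleGraph V),
        complementRank G ≤ t - 1 → (¬ ∃ K : Finset V, G.IsNClique s K) →
          Fintype.card V ≤ (s - 1) * (t - 1) := by
  obtain ⟨s, rfl⟩ := Nat.exists_eq_add_of_lt (Nat.zero_lt_of_lt hs)
  obtain ⟨t, rfl⟩ := Nat.exists_eq_add_of_le' (Nat.one_le_of_lt ht2)
  simp only [zero_add, Nat.add_sub_cancel]
  refine ⟨IsLeast.csInf_eq ⟨fun G => ?_, fun N hN => ?_⟩, fun V _ G hr hK =>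
    SimpleGraph.card_le_of_complementRank_le (by omega) hr hK⟩
  · by_contra! h
    have := SimpleGraph.card_le_of_complementRank_le (by omega : t ≤ 4)
      (Nat.le_of_lt_succ h.2) (not_exists.2 h.1)
    simp at this
  · by_contra hlt
    exact SimpleGraph.not_rankRamseyProperty (by omega) hN
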